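/- **Setting.** Consider $x(t+1)=f(x(t),u(t),w(t))$ with $f:\mathbb R^n\times\mathbb R^m\times\mathbb R^q\to\mathbb R^n$, constraints $(x(t),u(t))\in\mathbb Z$, disturbances $w(t)\in\mathbb W$, and a parameterized feedback $u=\pi(x,v)$. Put $f_\pi(x,v,w)=f(x,\pi(x,v),w)$, $\mathbb Z_\pi=\{(x,v):(x,\pi(x,v))\in\mathbb Z\}$ and, for a set $\Omega\subseteq\mathbb R^n$, $\overline{\mathbb Z}=\{(z,v):(z+\epsilon,v)\in\mathbb Z_\pi\ \forall\epsilon\in\Omega\}$. Let $L:\mathbb R^n\times\mathbb R^m\to\mathbb R$ be continuous and $L_\pi(x,v)=L(x,\pi(x,v))$. The stage cost $\ell$ is, on $\mathbb Z_\pi$, one of $L_\pi(z,v)$, $\int_\Omega L_\pi(z+\epsilon,v)\,d\epsilon$, $\max_{\epsilon\in\Omega}L_\pi(z+\epsilon,v)$ (with the integral, respectively the maximum, existing). For sequences $z(\cdot),v(\cdot)$ let $J_T=\sum_{t=0}^{T-1}\ell(z(t),v(t))$ and $J_\infty=\limsup_{T\to\infty}J_T\in[-\infty,\infty]$. The nominal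 dynamics are $z(t+1)=f_\pi(z(t),v(t),0)$. For $N\ge1$, $z_0\in\mathbb R^n$, terminal cost $V_f:\mathbb R^n\to\mathbb R$ and terminal region $\mathbb X_f\subseteq\mathbb R^n$, let $V_N(z_0)$ be the minimum of $J_N+V_f(z(N))$ over nominal trajectories with $z(0)=z_0$, $(z(t),v(t))\in\overline{\mathbb Z}$ for $0\le t<N$, and $z(N)\in\mathbb X_f$; let $\mathbb X_N$ be the set of $z_0$ for which such a trajectory exists. Let $V_\infty(z_0)\in[-\infty,\infty]$ be the infimum of $J_\infty$ over nominal trajectories with $z(0)=z_0$ and $(z(t),v(t))\in\overline{\mathbb Z}$ for all $t\ge0$. Suppose that for all $N\ge1$ the minimum $V_N(z_0)$ is attained for every $z_0\in\mathbb X_N$, and fix minimizers $(z_N^*(\cdot;z_0),v_N^*(\cdot;z_0))$. Suppose also that, for all $N\ge1$ and all $x\in\mathbb X_N\oplus\Omega$, the problem of minimizing $V_N(z_0)$ over $z_0\in\mathbb X_N$ with $x\in\{z_0\}\oplus\Omega$ has a minimizer, and fix one, $z_0^*(x)$ (it depends on $N$). Put $\mathbb Z_{cl}(z)=\{z_0^*(x^+):x^+\in\{f_\pi(z,v_N^*(0;z),0)\}\oplus\Omega\}$.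 A *closed-loop nominal sequence* with horizon $N$ is a sequence $z_N(0|t)$, $t\ge0$, with $z_N(0|0)\in\mathbb X_N$ and $z_N(0|t+1)\in\mathbb Z_{cl}(z_N(0|t))$ for all $t$; put $v_N(0|t)=v_N^*(0;z_N(0|t))$. Such a sequence need not satisfy the nominal dynamics. A function $[0,\infty)\to[0,\infty)$ is in $\mathcal K_\infty$ if it is continuous, strictly increasing, unbounded and zero at $0$, and in $\mathcal L$ if it is continuous, strictly decreasing and tends to $0$ at infinity. **Assumptions.** 1. $\mathbb Z$ and $\mathbb W$ are compact and convex with nonempty interior, and $0\in\operatorname{int}\mathbb W$. 2. $\Omega$ is robust control invariant: it is compact, and $f_\pi(x,v,w)-f_\pi(z,v,0)\in\Omega$ whenever $x-z\in\Omega$, $(x,v)\in\mathbb Z_\pi$, $w\in\mathbb W$. Both $\Omega$ and $\overline{\mathbb Z}$ have nonempty interior, and $\overline{\mathbb Z}\subseteq\mathbb Z_\pi$ (automatic if $0\in\Omega$). 3. $\ell$ is Lipschitz continuous on $\mathbb Z_\pi$. 4. $(z_s,v_s)$ minimizes $\ell$ over $\{(z,v)\in\overline{\mathbb Z}: z=f_\pi(z,v,0)\}$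 and lies in the interior of $\overline{\mathbb Z}$. 5. $\mathbb X_f$ is closed, $z_s\in\operatorname{int}\mathbb X_f$, $V_f$ is continuous on $\mathbb X_f$, and there is $\kappa_f:\mathbb X_f\to\mathbb R^m$ such that for all $z\in\mathbb X_f$: $(z,\kappa_f(z))\in\overline{\mathbb Z}$, $f_\pi(z,\kappa_f(z),0)\in\mathbb X_f$, and $V_f(f_\pi(z,\kappa_f(z),0))-V_f(z)\le-\ell(z,\kappa_f(z))+\ell(z_s,v_s)$. 6. There are $\alpha_\ell\in\mathcal K_\infty$ and a bounded $\lambda:\mathbb R^n\to\mathbb R$ such that $\lambda(z^+)-\lambda(z)\le\ell(z,v)-\ell(z_s,v_s)-\alpha_\ell(\|(z,v)-(z_s,v_s)\|)$ holds (a) for all $(z,v)\in\overline{\mathbb Z}$ with $z^+=f_\pi(z,v,0)$, and (b) for all $N\ge1$, $z\in\mathbb X_N$, $v=v_N^*(0;z)$ and all $z^+\in\mathbb Z_{cl}(z)$. 7. Exponential reachability: there are $c\ge0$ and $\rho\in[0,1)$ such that for every $z_0\in\bigcup_{N\ge1}\mathbb X_N$ some nominal trajectory with $z(0)=z_0$ satisfies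 $(z(t),v(t))\in\overline{\mathbb Z}$ and $\|(z(t),v(t))-(z_s,v_s)\|\le c\rho^t$ for all $t\ge0$. 8. Local $M$-step controllability: for some $M\ge1$ and all $\varepsilon>0$ there is $\delta>0$ such that any $y,y'$ with $\|y-z_s\|,\|y'-z_s\|\le\delta$ are joined by a nominal trajectory with $z(0)=y$, $z(M)=y'$ and $\|(z(t),v(t))-(z_s,v_s)\|\le\varepsilon$ for $0\le t<M$. 9. There is $\alpha_V\in\mathcal K_\infty$ with $|V_N(z)-V_N(z_s)|\le\alpha_V(\|z-z_s\|)$ for all $N\ge1$ and $z\in\mathbb X_N$. **Theorem.** There is $\delta_1\in\mathcal L$ such that for every $N\ge1$ and every closed-loop nominal sequence with horizon $N$ (in particular for every initial state $z_N(0|0)\in\mathbb X_N$), $$\limsup_{T\to\infty}\sum_{t=0}^{T-1}\ell(z_N(0|t),v_N(0|t))\ \le\ V_\infty(z_N(0|0))+\delta_1(N)$$ in $[-\infty,\infty]$. Moreover, if $\ell(z_s,v_s)=0$ (which can be achieved by subtracting a constant from $\ell$), then $V_\infty$ is finite on $\mathbb X_N$ for every $N\ge1$. -/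

import Mathlib

open Filter Topology MeasureTheory
open scoped NNReal

namespace TubeEMPC

/-- Class `𝓚∞`: continuous, strictly increasing, unbounded, zero at zero. -/
def ClassKInf (α : ℝ≥0 → ℝ≥0) : Prop :=
  Continuous α ∧ StrictMono α ∧ α 0 = 0 ∧ ∀ B : ℝ≥0, ∃ s, B ≤ α s

/-- Class `𝓛`: continuous, strictly decreasing, tending to zero at infinity. -/
def ClassL (δ : ℝ≥0 → ℝ≥0) : Prop :=
  Continuous δ ∧ StrictAnti δ ∧ Tendsto δ atTop (𝓝 0)

/-- The data of a tube-based economic MPC problem with terminal conditions (no properties). Pairs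
live in the product of two Euclidean spaces; its norm, the maximum of the two Euclidean norms, is
equivalent to the Euclidean one, and every condition below is invariant under this change. -/
structure Problem (n m q : ℕ) where
  /-- state transition map `f(x, u, w)` -/
  f : EuclideanSpace ℝ (Fin n) → EuclideanSpace ℝ (Fin m) → EuclideanSpace ℝ (Fin q) →
    EuclideanSpace ℝ (Fin n)
  /-- state and input constraint set -/
  ZZ : Set (EuclideanSpace ℝ (Fin n) × EuclideanSpace ℝ (Fin m))
  /-- disturbance set -/
  WW : Set (EuclideanSpace ℝ (Fin q))
  /-- parameterized feedback `u = π(x, v)` -/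
  fb : EuclideanSpace ℝ (Fin n) → EuclideanSpace ℝ (Fin m) → EuclideanSpace ℝ (Fin m)
  /-- robust control invariant set -/
  Ω : Set (EuclideanSpace ℝ (Fin n))
  /-- economic cost `L(x, u)` -/
  L : EuclideanSpace ℝ (Fin n) → EuclideanSpace ℝ (Fin m) → ℝ
  /-- stage cost of the nominal optimal control problem -/
  ℓ : EuclideanSpace ℝ (Fin n) × EuclideanSpace ℝ (Fin m) → ℝ
  /-- terminal cost -/
  Vf : EuclideanSpace ℝ (Fin n) → ℝ
  /-- terminal region -/
  Xf : Set (EuclideanSpace ℝ (Fin n))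
  /-- state of the robust optimal steady state -/
  zs : EuclideanSpace ℝ (Fin n)
  /-- artificial input of the robust optimal steady state -/
  vs : EuclideanSpace ℝ (Fin m)

namespace Problem

variable {n m q : ℕ} (P : Problem n m q)

/-- `f_π(x, v, w) = f(x, π(x, v), w)`. -/
def fpi (x : EuclideanSpace ℝ (Fin n)) (v : EuclideanSpace ℝ (Fin m))
    (w : EuclideanSpace ℝ (Fin q)) : EuclideanSpace ℝ (Fin n) :=
  P.f x (P.fb x v) w

/-- `ℤ_π = {(x, v) | (x, π(x, v)) ∈ ℤ}`. -/
def Zpi : Set (EuclideanSpace ℝ (Fin n) × EuclideanSpace ℝ (Fin m)) :=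
  {p | (p.1, P.fb p.1 p.2) ∈ P.ZZ}

/-- The tightened constraint set. -/
def Zbar : Set (EuclideanSpace ℝ (Fin n) × EuclideanSpace ℝ (Fin m)) :=
  {p | ∀ e ∈ P.Ω, (p.1 + e, p.2) ∈ P.Zpi}

/-- `L_π(x, v) = L(x, π(x, v))`. -/
def Lpi (x : EuclideanSpace ℝ (Fin n)) (v : EuclideanSpace ℝ (Fin m)) : ℝ :=
  P.L x (P.fb x v)

/-! ### Optimal control problems -/

/-- Trajectories admissible for the first `N` steps, starting at `z₀`. -/
def Admissible (N : ℕ) (z₀ : EuclideanSpace ℝ (Fin n))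
    (z : ℕ → EuclideanSpace ℝ (Fin n)) (v : ℕ → EuclideanSpace ℝ (Fin m)) : Prop :=
  z 0 = z₀ ∧ ∀ t < N, z (t + 1) = P.fpi (z t) (v t) 0 ∧ (z t, v t) ∈ P.Zbar

/-- Trajectories admissible for all times, starting at `z₀`. -/
def AdmissibleInf (z₀ : EuclideanSpace ℝ (Fin n))
    (z : ℕ → EuclideanSpace ℝ (Fin n)) (v : ℕ → EuclideanSpace ℝ (Fin m)) : Prop :=
  z 0 = z₀ ∧ ∀ t, z (t + 1) = P.fpi (z t) (v t) 0 ∧ (z t, v t) ∈ P.Zbar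

/-- Feasibility for the OCP with terminal conditions and horizon `N`. -/
def Feasible (N : ℕ) (z₀ : EuclideanSpace ℝ (Fin n))
    (z : ℕ → EuclideanSpace ℝ (Fin n)) (v : ℕ → EuclideanSpace ℝ (Fin m)) : Prop :=
  P.Admissible N z₀ z v ∧ z N ∈ P.Xf

/-- The cost accumulated over `N` steps. -/
noncomputable def J (N : ℕ) (z : ℕ → EuclideanSpace ℝ (Fin n))
    (v : ℕ → EuclideanSpace ℝ (Fin m)) : ℝ :=
  ∑ t ∈ Finset.range N, P.ℓ (z t, v t)

/-- Infinite horizon cost `limsup_N J_N`, in the extended reals. -/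
noncomputable def Jinf (z : ℕ → EuclideanSpace ℝ (Fin n))
    (v : ℕ → EuclideanSpace ℝ (Fin m)) : EReal :=
  limsup (fun N : ℕ => ((P.J N z v : ℝ) : EReal)) atTop

/-- The set of initial nominal states feasible for horizon `N`. -/
def XN (N : ℕ) : Set (EuclideanSpace ℝ (Fin n)) :=
  {z₀ | ∃ z v, P.Feasible N z₀ z v}

/-- Optimal value `V_N` of the OCP with terminal conditions. It is only used on `XN N`, where a
minimizer exists by `IsOptimalSelection`. -/
noncomputable def V (N : ℕ) (z₀ : EuclideanSpace ℝ (Fin n)) : ℝ :=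
  sInf {c | ∃ z v, P.Feasible N z₀ z v ∧ c = P.J N z v + P.Vf (z N)}

/-- Optimal value `V_∞` of the infinite horizon OCP, in the extended reals. -/
noncomputable def Vinf (z₀ : EuclideanSpace ℝ (Fin n)) : EReal :=
  sInf {c | ∃ z v, P.AdmissibleInf z₀ z v ∧ c = P.Jinf z v}

/-- `zopt N z₀`, `vopt N z₀` are minimizers of the OCP with horizon `N` and initial state `z₀`, for
every horizon and every feasible initial state. -/
def IsOptimalSelection (zopt : ℕ → EuclideanSpace ℝ (Fin n) → ℕ → EuclideanSpace ℝ (Fin n))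
    (vopt : ℕ → EuclideanSpace ℝ (Fin n) → ℕ → EuclideanSpace ℝ (Fin m)) : Prop :=
  ∀ N, 1 ≤ N → ∀ z₀ ∈ P.XN N,
    P.Feasible N z₀ (zopt N z₀) (vopt N z₀) ∧
    ∀ z v, P.Feasible N z₀ z v →
      P.J N (zopt N z₀) (vopt N z₀) + P.Vf (zopt N z₀ N) ≤ P.J N z v + P.Vf (z N)

/-- `ini N x` is a minimizer `z₀*(x)` of `V_N(z₀)` over the feasible `z₀` with `x ∈ {z₀} ⊕ Ω`,
for every horizon and every `x` for which this problem is feasible. -/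
def IsOptimalInitial (ini : ℕ → EuclideanSpace ℝ (Fin n) → EuclideanSpace ℝ (Fin n)) : Prop :=
  ∀ N, 1 ≤ N → ∀ x, (∃ z₀ ∈ P.XN N, x - z₀ ∈ P.Ω) →
    (ini N x ∈ P.XN N ∧ x - ini N x ∈ P.Ω) ∧
    ∀ z₀ ∈ P.XN N, x - z₀ ∈ P.Ω → P.V N (ini N x) ≤ P.V N z₀

/-- The set of all possible next nominal states: `z₀*(x⁺)` for
`x⁺ ∈ {f_π(z, v_N(0; z), 0)} ⊕ Ω`. -/
def Zcl (vopt : ℕ → EuclideanSpace ℝ (Fin n) → ℕ → EuclideanSpace ℝ (Fin m))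
    (ini : ℕ → EuclideanSpace ℝ (Fin n) → EuclideanSpace ℝ (Fin n))
    (N : ℕ) (z : EuclideanSpace ℝ (Fin n)) : Set (EuclideanSpace ℝ (Fin n)) :=
  {z' | ∃ e ∈ P.Ω, z' = ini N (P.fpi z (vopt N z 0) 0 + e)}

/-- Closed-loop nominal sequences `z(t) = z_N(0|t)` of the MPC scheme with horizon `N`. They need
not be trajectories of the nominal system. -/
def IsClosedLoop (vopt : ℕ → EuclideanSpace ℝ (Fin n) → ℕ → EuclideanSpace ℝ (Fin m))
    (ini : ℕ → EuclideanSpace ℝ (Fin n) → EuclideanSpace ℝ (Fin n))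
    (N : ℕ) (z : ℕ → EuclideanSpace ℝ (Fin n)) : Prop :=
  z 0 ∈ P.XN N ∧ ∀ t, z (t + 1) ∈ P.Zcl vopt ini N (z t)

/-- Infinite horizon closed-loop performance, the `limsup` over `T` of
`∑_{t < T} ℓ(z_N(0|t), v_N(0|t))`. -/
noncomputable def JclInf
    (vopt : ℕ → EuclideanSpace ℝ (Fin n) → ℕ → EuclideanSpace ℝ (Fin m))
    (N : ℕ) (z : ℕ → EuclideanSpace ℝ (Fin n)) : EReal :=
  P.Jinf z (fun t => vopt N (z t) 0)

/-! ### Assumptions -/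

/-- The constraint sets are compact and convex with nonempty interior, and the disturbance set
contains the origin in its interior. -/
def ConstraintSets : Prop :=
  (IsCompact P.ZZ ∧ Convex ℝ P.ZZ ∧ (interior P.ZZ).Nonempty) ∧
  (IsCompact P.WW ∧ Convex ℝ P.WW ∧ (interior P.WW).Nonempty) ∧
  0 ∈ interior P.WW

/-- `Ω` is robust control invariant for the error system under the feedback `π`. -/
def IsRCI : Prop :=
  IsCompact P.Ω ∧
  ∀ x z v, x - z ∈ P.Ω → (x, v) ∈ P.Zpi →
    ∀ w ∈ P.WW, P.fpi x v w - P.fpi z v 0 ∈ P.Ω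

/-- `Ω` is an RCI set, and it and the tightened constraint set have nonempty interior. The
tightened set is indeed a tightening of `ℤ_π` (which is automatic if `0 ∈ Ω`), so that the stage
cost is defined on it. -/
def RCIAssumption : Prop :=
  P.IsRCI ∧ (interior P.Ω).Nonempty ∧ (interior P.Zbar).Nonempty ∧ P.Zbar ⊆ P.Zpi

/-- The stage cost is one of `L_π`, `L_π^int` and `L_π^max` on `ℤ_π`. -/
def IsStageCost : Prop :=
  (∀ p ∈ P.Zpi, P.ℓ p = P.Lpi p.1 p.2) ∨
  (∀ p ∈ P.Zpi, IntegrableOn (fun e => P.Lpi (p.1 + e) p.2) P.Ω ∧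
    P.ℓ p = ∫ e in P.Ω, P.Lpi (p.1 + e) p.2) ∨
  (∀ p ∈ P.Zpi, IsGreatest ((fun e => P.Lpi (p.1 + e) p.2) '' P.Ω) (P.ℓ p))

/-- `L` is continuous, the stage cost is built from it, and it is Lipschitz on `ℤ_π`. -/
def StageCostAssumption : Prop :=
  Continuous (fun p : EuclideanSpace ℝ (Fin n) × EuclideanSpace ℝ (Fin m) => P.L p.1 p.2) ∧
  P.IsStageCost ∧ ∃ κ : ℝ≥0, 0 < κ ∧ LipschitzOnWith κ P.ℓ P.Zpi

/-- `(zs, vs)` minimizes the stage cost over the admissible steady states and lies in the interior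
of the tightened constraint set. -/
def ROSSAssumption : Prop :=
  P.zs = P.fpi P.zs P.vs 0 ∧
  (∀ z v, (z, v) ∈ P.Zbar → z = P.fpi z v 0 → P.ℓ (P.zs, P.vs) ≤ P.ℓ (z, v)) ∧
  (P.zs, P.vs) ∈ interior P.Zbar

/-- Terminal region, terminal cost and local auxiliary controller. -/
def TerminalAssumption : Prop :=
  IsClosed P.Xf ∧ P.zs ∈ interior P.Xf ∧ ContinuousOn P.Vf P.Xf ∧
  ∃ κf : EuclideanSpace ℝ (Fin n) → EuclideanSpace ℝ (Fin m), ∀ z ∈ P.Xf,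
    (z, κf z) ∈ P.Zbar ∧ P.fpi z (κf z) 0 ∈ P.Xf ∧
    P.Vf (P.fpi z (κf z) 0) - P.Vf z ≤ -P.ℓ (z, κf z) + P.ℓ (P.zs, P.vs)

/-- Strict dissipativity of the nominal system with respect to the supply rate
`ℓ(z, v) - ℓ(zs, vs)`, with bounded storage function `lam`. -/
def StrictlyDissipative (lam : EuclideanSpace ℝ (Fin n) → ℝ) (α : ℝ≥0 → ℝ≥0) : Prop :=
  ClassKInf α ∧ (∃ B : ℝ, ∀ z, |lam z| ≤ B) ∧
  ∀ z v, (z, v) ∈ P.Zbar →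
    lam (P.fpi z v 0) - lam z ≤
      P.ℓ (z, v) - P.ℓ (P.zs, P.vs) - (α ‖(z, v) - (P.zs, P.vs)‖₊ : ℝ)

/-- The dissipation inequality along all possible closed-loop transitions. -/
def StronglyDissipative
    (vopt : ℕ → EuclideanSpace ℝ (Fin n) → ℕ → EuclideanSpace ℝ (Fin m))
    (ini : ℕ → EuclideanSpace ℝ (Fin n) → EuclideanSpace ℝ (Fin n))
    (lam : EuclideanSpace ℝ (Fin n) → ℝ) (α : ℝ≥0 → ℝ≥0) : Prop :=
  ∀ N, 1 ≤ N → ∀ z ∈ P.XN N, ∀ z' ∈ P.Zcl vopt ini N z,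
    lam z' - lam z ≤
      P.ℓ (z, vopt N z 0) - P.ℓ (P.zs, P.vs) -
        (α ‖(z, vopt N z 0) - (P.zs, P.vs)‖₊ : ℝ)

/-- Dissipativity and strong dissipativity, with the same storage function and the same `α`. -/
def DissipativityAssumption
    (vopt : ℕ → EuclideanSpace ℝ (Fin n) → ℕ → EuclideanSpace ℝ (Fin m))
    (ini : ℕ → EuclideanSpace ℝ (Fin n) → EuclideanSpace ℝ (Fin n)) : Prop :=
  ∃ lam α, P.StrictlyDissipative lam α ∧ P.StronglyDissipative vopt ini lam α

/-- Exponential reachability of the steady state from all feasible initial states, with uniform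
constants. -/
def ExponentiallyReachable : Prop :=
  ∃ c ρ : ℝ, 0 ≤ c ∧ 0 ≤ ρ ∧ ρ < 1 ∧
    ∀ N, 1 ≤ N → ∀ z₀ ∈ P.XN N, ∃ z v, P.AdmissibleInf z₀ z v ∧
      ∀ t, ‖(z t, v t) - (P.zs, P.vs)‖ ≤ c * ρ ^ t

/-- Local `M`-step controllability at `(zs, vs)`: any two states close to `zs` are joined by an
`M`-step trajectory of the nominal system whose states and inputs stay close to `(zs, vs)`. -/
def LocallyControllable : Prop :=
  ∃ M : ℕ, 1 ≤ M ∧ ∀ ε > 0, ∃ δ > 0, ∀ y y',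
    ‖y - P.zs‖ ≤ δ → ‖y' - P.zs‖ ≤ δ →
    ∃ (z : ℕ → EuclideanSpace ℝ (Fin n)) (v : ℕ → EuclideanSpace ℝ (Fin m)),
      z 0 = y ∧ z M = y' ∧
      ∀ t < M, z (t + 1) = P.fpi (z t) (v t) 0 ∧ ‖(z t, v t) - (P.zs, P.vs)‖ ≤ ε

/-- Continuity of the optimal value functions at the steady state, uniformly in the horizon. -/
def ValueContinuity : Prop :=
  ∃ α : ℝ≥0 → ℝ≥0, ClassKInf α ∧ ∀ N, 1 ≤ N → ∀ z ∈ P.XN N,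
    |P.V N z - P.V N P.zs| ≤ (α ‖z - P.zs‖₊ : ℝ)

end Problem

end TubeEMPC

/-!
Let `ℓ(zs, vs) = 0`; the other two signs are degenerate, since then `V_∞ = ⊤` or every closed-loop
cost is `⊥`.

Along the closed loop the optimal value decreases by at least the stage cost, because the
re-optimized initial state can only lower it further. Strong dissipativity forces the closed loop
to converge to `zs`, so its cost is at most `V_N(z₀) - V_N(zs)`, and it remains to compare this
difference with `V_∞(z₀)`, uniformly in `z₀`.

By dissipativity, every infinite trajectory of cost less than `C` enters a given neighbourhood of
`zs` at some time `k < K`, where `K` depends on `C` and the neighbourhood only. Switching there to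
an optimal trajectory gives `V_N(z₀) ≤ J_k + V_{N-k}(z(k)) ≈ J_k + V_{N-k}(zs)`. The sequence
`V_N(zs)` is nonincreasing, by the terminal controller, and bounded below, hence Cauchy, so
`V_{N-k}(zs) ≈ V_N(zs)` for large `N`. Finally `J_k` is nearly below the cost of the whole
trajectory, since the storage function is continuous at `zs` by local controllability and the
trajectory converges to `zs`.
-/

namespace TubeEMPC

/-! ### Comparison functions -/

theorem classL_one_add_inv : ClassL fun s => (1 + s)⁻¹ := by
  have hpos (s : ℝ≥0) : 0 < 1 + s := by positivity
  refine ⟨(continuous_const.add continuous_id).inv₀ fun s => (hpos s).ne', fun s t h => ?_, ?_⟩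
  · exact inv_strictAnti₀ (hpos s) (by gcongr)
  · exact tendsto_inv_atTop_zero.comp (tendsto_atTop_mono (fun s => le_add_self) tendsto_id)

theorem exists_continuous_antitone_ge {g : ℕ → ℝ≥0} (hg : Tendsto g atTop (𝓝 0)) :
    ∃ D : ℝ≥0 → ℝ≥0, Continuous D ∧ Antitone D ∧ Tendsto D atTop (𝓝 0) ∧ ∀ k : ℕ, g k ≤ D k := by
  obtain ⟨K, hK⟩ := hg.bddAbove_range
  replace hK (k : ℕ) : g k ≤ K := hK ⟨k, rfl⟩
  have hbdd (s : ℝ≥0) : BddAbove (Set.range fun k : ℕ => g k - (s - k)) :=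
    ⟨K, Set.forall_mem_range.2 fun k => tsub_le_self.trans (hK k)⟩
  -- Subtraction in `ℝ≥0` is truncated: each term is constant up to `s = k`, then decreases to `0`.
  refine ⟨fun s => ⨆ k : ℕ, (g k - (s - k)), ?_, fun s t hst => ?_, ?_, fun k => ?_⟩
  · have hle (s t : ℝ≥0) : ⨆ k : ℕ, (g k - (s - k)) ≤ (⨆ k : ℕ, (g k - (t - k))) + (t - s) := by
      refine ciSup_le fun k => le_trans ?_ (add_le_add_left (le_ciSup (hbdd t) k) _)
      rw [tsub_le_iff_right, add_assoc]
      exact le_tsub_add.trans (by gcongr; exact tsub_le_tsub_add_tsub)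
    refine NNReal.isEmbedding_coe.continuous_iff.2
      (LipschitzWith.of_le_add fun s t => ?_).continuous
    have hdist : ((t - s : ℝ≥0) : ℝ) ≤ dist s t := by
      rw [NNReal.coe_sub_def, dist_comm, NNReal.dist_eq]
      exact max_le (le_abs_self _) (abs_nonneg _)
    have hle' : ((⨆ k : ℕ, (g k - (s - k)) : ℝ≥0) : ℝ) ≤
        (⨆ k : ℕ, (g k - (t - k)) : ℝ≥0) + (t - s : ℝ≥0) := mod_cast hle s t
    exact hle'.trans (add_le_add_right hdist _)
  · exact ciSup_mono (hbdd s) fun k => by gcongr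
  · refine tendsto_order.2 ⟨fun a ha => absurd ha not_lt_zero, fun ε hε => ?_⟩
    obtain ⟨a, ha, haε⟩ := exists_between hε
    obtain ⟨k₀, hk₀⟩ := eventually_atTop.1 (hg.eventually_le_const ha)
    filter_upwards [eventually_ge_atTop (K + k₀)] with s hs
    refine (ciSup_le fun k => ?_).trans_lt haε
    rcases le_total k₀ k with hk | hk
    · exact tsub_le_self.trans (hk₀ k hk)
    · have hKs : K ≤ s - k := le_tsub_of_add_le_right (le_trans (by gcongr) hs)
      rw [tsub_eq_zero_of_le ((hK k).trans hKs)]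
      exact ha.le
  · simpa using le_ciSup (hbdd k) k

theorem exists_classL_ge {g : ℕ → ℝ≥0} (hg : Tendsto g atTop (𝓝 0)) :
    ∃ δ : ℝ≥0 → ℝ≥0, ClassL δ ∧ ∀ k : ℕ, g k ≤ δ k := by
  obtain ⟨D, hcont, hanti, hlim, hge⟩ := exists_continuous_antitone_ge hg
  obtain ⟨hcont', hanti', hlim'⟩ := classL_one_add_inv
  exact ⟨fun s => D s + (1 + s)⁻¹,
    ⟨hcont.add hcont', hanti.add_strictAnti hanti', by simpa using hlim.add hlim'⟩,
    fun k => (hge k).trans le_self_add⟩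

theorem exists_classL_of_eventually {Q : ℕ → ℝ≥0 → Prop} (hmono : ∀ N, Monotone (Q N))
    (hex : ∀ N, ∃ a, Q N a) (hev : ∀ η > 0, ∀ᶠ N in atTop, Q N η) :
    ∃ δ : ℝ≥0 → ℝ≥0, ClassL δ ∧ ∀ N : ℕ, Q N (δ N) := by
  have hnear (N : ℕ) : ∃ a, Q N a ∧ a < sInf {a | Q N a} + (1 + (N : ℝ≥0))⁻¹ :=
    exists_lt_of_csInf_lt (hex N) (lt_add_of_pos_right _ (by positivity))
  choose g hQ hg using hnear
  have hInf : Tendsto (fun N => sInf {a | Q N a}) atTop (𝓝 0) := by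
    refine tendsto_order.2 ⟨fun a ha => absurd ha not_lt_zero, fun ε hε => ?_⟩
    obtain ⟨a, ha, haε⟩ := exists_between hε
    filter_upwards [hev a ha] with N hN
    exact (csInf_le (OrderBot.bddBelow _) hN).trans_lt haε
  have hinv : Tendsto (fun N : ℕ => (1 + (N : ℝ≥0))⁻¹) atTop (𝓝 0) :=
    classL_one_add_inv.2.2.comp tendsto_natCast_atTop_atTop
  have hlim : Tendsto g atTop (𝓝 0) :=
    tendsto_of_tendsto_of_tendsto_of_le_of_le tendsto_const_nhds
      (by simpa using hInf.add hinv) (fun _ => zero_le) fun N => (hg N).le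
  obtain ⟨δ, hδ, hle⟩ := exists_classL_ge hlim
  exact ⟨δ, hδ, fun N => hmono N (hle N) (hQ N)⟩

theorem ClassKInf.tendsto_zero_of_sum_le {α : ℝ≥0 → ℝ≥0} (hα : ClassKInf α) {r : ℕ → ℝ≥0} {S : ℝ}
    (h : ∀ T, ∑ t ∈ Finset.range T, (α (r t) : ℝ) ≤ S) : Tendsto r atTop (𝓝 0) := by
  have hlim : Tendsto (fun t => α (r t)) atTop (𝓝 0) := NNReal.tendsto_coe.1
    (summable_of_sum_range_le (fun t => NNReal.coe_nonneg _) h).tendsto_atTop_zero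
  refine tendsto_order.2 ⟨fun a ha => absurd ha not_lt_zero, fun a ha => ?_⟩
  filter_upwards [hlim.eventually_lt_const (hα.2.2.1 ▸ hα.2.1 ha)] with t ht
  exact hα.2.1.lt_iff_lt.1 ht

/-! ### Concatenation of trajectories -/

/-- The sequence that follows `a` up to time `k - 1` and `b`, restarted, from time `k` on. It
concatenates trajectories; the value at time `k` is `b 0`. -/
def concat {X : Type*} (k : ℕ) (a b : ℕ → X) (t : ℕ) : X :=
  if t < k then a t else b (t - k)

section Concat

variable {X : Type*} {k t : ℕ} {a b : ℕ → X}

theorem concat_of_lt (h : t < k) : concat k a b t = a t := if_pos h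

theorem concat_add : concat k a b (k + t) = b t := by simp [concat]

theorem concat_of_le (hab : b 0 = a k) (h : t ≤ k) : concat k a b t = a t := by
  rcases h.lt_or_eq with h | rfl
  · exact concat_of_lt h
  · exact concat_add.trans hab

end Concat

namespace Problem

variable {n m q : ℕ} {P : Problem n m q} {k l N T : ℕ} {y z₀ : EuclideanSpace ℝ (Fin n)}
  {z z' : ℕ → EuclideanSpace ℝ (Fin n)} {v v' : ℕ → EuclideanSpace ℝ (Fin m)}

theorem J_add : P.J (k + l) z v = P.J k z v + P.J l (fun t => z (k + t)) (fun t => v (k + t)) :=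
  Finset.sum_range_add _ _ _

theorem J_concat :
    P.J (k + l) (concat k z z') (concat k v v') = P.J k z v + P.J l z' v' := by
  rw [J_add]
  simp only [concat_add]
  congr 1
  refine Finset.sum_congr rfl fun t ht => ?_
  rw [concat_of_lt (Finset.mem_range.1 ht), concat_of_lt (Finset.mem_range.1 ht)]

theorem Admissible.concat (h : P.Admissible k z₀ z v) (h' : P.Feasible l (z k) z' v') :
    P.Feasible (k + l) z₀ (concat k z z') (concat k v v') := by
  obtain ⟨⟨h0', hstep'⟩, hXf⟩ := h'
  refine ⟨⟨(concat_of_le h0' (Nat.zero_le k)).trans h.1, fun t ht => ?_⟩, concat_add ▸ hXf⟩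
  rcases lt_or_ge t k with htk | htk
  · rw [concat_of_le h0' htk, concat_of_lt htk, concat_of_lt htk]
    exact h.2 t htk
  · obtain ⟨s, rfl⟩ := Nat.exists_eq_add_of_le htk
    rw [add_assoc, concat_add, concat_add, concat_add]
    exact hstep' s (by omega)

theorem Feasible.shift (h : P.Feasible (k + l) z₀ z v) :
    P.Feasible l (z k) (fun t => z (k + t)) (fun t => v (k + t)) :=
  ⟨⟨rfl, fun t ht => h.1.2 (k + t) (by omega)⟩, h.2⟩

theorem AdmissibleInf.take (h : P.AdmissibleInf z₀ z v) (k : ℕ) : P.Admissible k z₀ z v :=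
  ⟨h.1, fun t _ => h.2 t⟩

theorem AdmissibleInf.shift (h : P.AdmissibleInf z₀ z v) (k : ℕ) :
    P.AdmissibleInf (z k) (fun t => z (k + t)) (fun t => v (k + t)) :=
  ⟨rfl, fun t => h.2 (k + t)⟩

/-! ### Dynamic programming -/

variable (P) in
/-- The part of `TerminalAssumption` that drives dynamic programming: a local feedback keeps the
state in the terminal region, and the terminal cost pays for the stage cost in excess of the
steady-state cost. -/
def TerminalDecrease : Prop :=
  ∃ κf : EuclideanSpace ℝ (Fin n) → EuclideanSpace ℝ (Fin m), ∀ z ∈ P.Xf,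
    (z, κf z) ∈ P.Zbar ∧ P.fpi z (κf z) 0 ∈ P.Xf ∧
    P.Vf (P.fpi z (κf z) 0) - P.Vf z ≤ -P.ℓ (z, κf z) + P.ℓ (P.zs, P.vs)

theorem Feasible.extend (h_term : P.TerminalDecrease) (h : P.Feasible k z₀ z v) :
    ∃ y u, P.Feasible (k + 1) z₀ y u ∧
      P.J (k + 1) y u + P.Vf (y (k + 1)) ≤ P.J k z v + P.Vf (z k) + P.ℓ (P.zs, P.vs) := by
  obtain ⟨κf, hκ⟩ := h_term
  obtain ⟨hZ, hXf, hdecr⟩ := hκ _ h.2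
  let y : ℕ → EuclideanSpace ℝ (Fin n)
    | 0 => z k
    | _ + 1 => P.fpi (z k) (κf (z k)) 0
  let u : ℕ → EuclideanSpace ℝ (Fin m) := fun _ => κf (z k)
  have hy : P.Feasible 1 (z k) y u := by
    refine ⟨⟨rfl, fun t ht => ?_⟩, hXf⟩
    obtain rfl : t = 0 := by omega
    exact ⟨rfl, hZ⟩
  have hJ : P.J 1 y u = P.ℓ (z k, κf (z k)) := Finset.sum_range_one _
  refine ⟨_, _, h.1.concat hy, ?_⟩
  rw [J_concat, concat_add, hJ]
  change _ + P.Vf (P.fpi (z k) (κf (z k)) 0) ≤ _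
  linarith

theorem XN_subset_succ (h_term : P.TerminalDecrease) : P.XN N ⊆ P.XN (N + 1) := by
  rintro z₀ ⟨z, v, h⟩
  obtain ⟨y, u, hy, -⟩ := h.extend h_term
  exact ⟨y, u, hy⟩

theorem feasible_zero (hz : z₀ ∈ P.Xf) : P.Feasible 0 z₀ (fun _ => z₀) v :=
  ⟨⟨rfl, fun _ ht => absurd ht (Nat.not_lt_zero _)⟩, hz⟩

theorem Xf_subset_XN (h_term : P.TerminalDecrease) (N : ℕ) : P.Xf ⊆ P.XN N := by
  induction N with
  | zero => exact fun z₀ hz => ⟨_, 0, feasible_zero hz⟩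
  | succ N ih => exact ih.trans (XN_subset_succ h_term)

section Value

variable {zopt : ℕ → EuclideanSpace ℝ (Fin n) → ℕ → EuclideanSpace ℝ (Fin n)}
  {vopt : ℕ → EuclideanSpace ℝ (Fin n) → ℕ → EuclideanSpace ℝ (Fin m)}
  {ini : ℕ → EuclideanSpace ℝ (Fin n) → EuclideanSpace ℝ (Fin n)}

theorem V_eq (h_opt : P.IsOptimalSelection zopt vopt) (hN : 1 ≤ N) (hz : z₀ ∈ P.XN N) :
    P.V N z₀ = P.J N (zopt N z₀) (vopt N z₀) + P.Vf (zopt N z₀ N) := by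
  obtain ⟨hfeas, hmin⟩ := h_opt N hN z₀ hz
  refine IsLeast.csInf_eq ⟨⟨_, _, hfeas, rfl⟩, ?_⟩
  rintro _ ⟨z, v, h, rfl⟩
  exact hmin z v h

theorem Feasible.V_le (h_opt : P.IsOptimalSelection zopt vopt) (hN : 1 ≤ N)
    (h : P.Feasible N z₀ z v) : P.V N z₀ ≤ P.J N z v + P.Vf (z N) := by
  have hz : z₀ ∈ P.XN N := ⟨z, v, h⟩
  exact (V_eq h_opt hN hz).trans_le ((h_opt N hN z₀ hz).2 z v h)

theorem Admissible.V_add_le (h_opt : P.IsOptimalSelection zopt vopt) (hl : 1 ≤ l)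
    (h : P.Admissible k z₀ z v) (hz : z k ∈ P.XN l) :
    P.V (k + l) z₀ ≤ P.J k z v + P.V l (z k) := by
  have hle := (h.concat (h_opt l hl _ hz).1).V_le h_opt (by omega)
  rwa [J_concat, concat_add, add_assoc, ← V_eq h_opt hl hz] at hle

theorem V_succ_le (h_opt : P.IsOptimalSelection zopt vopt) (h_term : P.TerminalDecrease)
    (hN : 1 ≤ N) (hz : z₀ ∈ P.XN N) : P.V (N + 1) z₀ ≤ P.V N z₀ + P.ℓ (P.zs, P.vs) := by
  obtain ⟨y, u, hy, hJ⟩ := (h_opt N hN z₀ hz).1.extend h_term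
  rw [V_eq h_opt hN hz]
  exact (hy.V_le h_opt (by omega)).trans hJ

theorem V_one_le (h_opt : P.IsOptimalSelection zopt vopt) (h_term : P.TerminalDecrease)
    (hz : z₀ ∈ P.Xf) : P.V 1 z₀ ≤ P.Vf z₀ + P.ℓ (P.zs, P.vs) := by
  obtain ⟨y, u, hy, hJ⟩ := (feasible_zero (v := 0) hz).extend h_term
  refine (hy.V_le h_opt le_rfl).trans (hJ.trans_eq ?_)
  simp [J]

/-! ### Closed-loop decrease of the optimal value -/

theorem V_nominal_succ_le (h_opt : P.IsOptimalSelection zopt vopt) (h_term : P.TerminalDecrease)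
    (hN : 1 ≤ N) (hz : z₀ ∈ P.XN N) :
    P.fpi z₀ (vopt N z₀ 0) 0 ∈ P.XN N ∧
      P.V N (P.fpi z₀ (vopt N z₀ 0) 0) ≤
        P.V N z₀ - P.ℓ (z₀, vopt N z₀ 0) + P.ℓ (P.zs, P.vs) := by
  obtain ⟨l, rfl⟩ := Nat.exists_eq_add_of_le hN
  obtain ⟨hfeas, -⟩ := h_opt _ hN z₀ hz
  obtain ⟨y, u, hy, hJ⟩ := hfeas.shift.extend h_term
  have hsucc : zopt (1 + l) z₀ 1 = P.fpi z₀ (vopt (1 + l) z₀ 0) 0 := by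
    rw [← zero_add 1, (hfeas.1.2 0 (by omega)).1, hfeas.1.1]
  have hfirst : P.J 1 (zopt (1 + l) z₀) (vopt (1 + l) z₀) = P.ℓ (z₀, vopt (1 + l) z₀ 0) := by
    simp [J, hfeas.1.1]
  rw [hsucc, add_comm l 1] at hy
  rw [add_comm l 1] at hJ
  refine ⟨⟨y, u, hy⟩, (hy.V_le h_opt hN).trans (hJ.trans_eq ?_)⟩
  rw [V_eq h_opt hN hz, J_add, hfirst]
  ring

theorem V_le_of_mem_Zcl (h_opt : P.IsOptimalSelection zopt vopt) (h_ini : P.IsOptimalInitial ini)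
    (h_term : P.TerminalDecrease) (hN : 1 ≤ N) (hz : z₀ ∈ P.XN N) (hy : y ∈ P.Zcl vopt ini N z₀) :
    y ∈ P.XN N ∧ P.V N y ≤ P.V N z₀ - P.ℓ (z₀, vopt N z₀ 0) + P.ℓ (P.zs, P.vs) := by
  obtain ⟨e, he, rfl⟩ := hy
  obtain ⟨hX, hV⟩ := V_nominal_succ_le h_opt h_term hN hz
  have he' : P.fpi z₀ (vopt N z₀ 0) 0 + e - P.fpi z₀ (vopt N z₀ 0) 0 ∈ P.Ω := by
    rwa [add_sub_cancel_left]
  obtain ⟨⟨hmem, -⟩, hmin⟩ := h_ini N hN _ ⟨_, hX, he'⟩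
  exact ⟨hmem, (hmin _ hX he').trans hV⟩

theorem IsClosedLoop.mem_XN (h_opt : P.IsOptimalSelection zopt vopt)
    (h_ini : P.IsOptimalInitial ini) (h_term : P.TerminalDecrease) (hN : 1 ≤ N)
    (hz : P.IsClosedLoop vopt ini N z) (T : ℕ) : z T ∈ P.XN N := by
  induction T with
  | zero => exact hz.1
  | succ T ih => exact (V_le_of_mem_Zcl h_opt h_ini h_term hN ih (hz.2 T)).1

theorem IsClosedLoop.J_le (h_opt : P.IsOptimalSelection zopt vopt)
    (h_ini : P.IsOptimalInitial ini) (h_term : P.TerminalDecrease) (hN : 1 ≤ N)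
    (hz : P.IsClosedLoop vopt ini N z) (T : ℕ) :
    P.J T z (fun t => vopt N (z t) 0) ≤ P.V N (z 0) - P.V N (z T) + T * P.ℓ (P.zs, P.vs) := by
  induction T with
  | zero => simp [J]
  | succ T ih =>
    have hX := hz.mem_XN h_opt h_ini h_term hN T
    have hdecr := (V_le_of_mem_Zcl h_opt h_ini h_term hN hX (hz.2 T)).2
    rw [J, Finset.sum_range_succ, ← J]
    push_cast
    linarith

end Value

/-! ### Dissipativity -/

variable {lam : EuclideanSpace ℝ (Fin n) → ℝ} {α : ℝ≥0 → ℝ≥0} {B C S : ℝ}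

variable (P) in
/-- The dissipation inequality holds along the first `T` steps of `(z, v)`. The nominal dynamics are
not required, so that this applies both to nominal trajectories and to closed-loop sequences. -/
def DissipatesAlong (lam : EuclideanSpace ℝ (Fin n) → ℝ) (α : ℝ≥0 → ℝ≥0) (T : ℕ)
    (z : ℕ → EuclideanSpace ℝ (Fin n)) (v : ℕ → EuclideanSpace ℝ (Fin m)) : Prop :=
  ∀ t < T, lam (z (t + 1)) - lam (z t) ≤
    P.ℓ (z t, v t) - P.ℓ (P.zs, P.vs) - (α ‖(z t, v t) - (P.zs, P.vs)‖₊ : ℝ)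

theorem Admissible.dissipatesAlong (h : P.StrictlyDissipative lam α)
    (hz : P.Admissible T z₀ z v) : P.DissipatesAlong lam α T z v := fun t ht => by
  rw [(hz.2 t ht).1]
  exact h.2.2 _ _ (hz.2 t ht).2

theorem DissipatesAlong.add_sum_le_J (h : P.DissipatesAlong lam α T z v) :
    lam (z T) - lam (z 0) + T * P.ℓ (P.zs, P.vs) +
      ∑ t ∈ Finset.range T, (α ‖(z t, v t) - (P.zs, P.vs)‖₊ : ℝ) ≤ P.J T z v := by
  have hsum := Finset.sum_le_sum fun t ht => h t (Finset.mem_range.1 ht)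
  rw [Finset.sum_range_sub (fun t => lam (z t)), Finset.sum_sub_distrib, Finset.sum_sub_distrib,
    Finset.sum_const, Finset.card_range, nsmul_eq_mul] at hsum
  rw [J]
  linarith

theorem DissipatesAlong.le_J (h : P.DissipatesAlong lam α T z v) :
    lam (z T) - lam (z 0) + T * P.ℓ (P.zs, P.vs) ≤ P.J T z v :=
  (le_add_of_nonneg_right (Finset.sum_nonneg fun _ _ => NNReal.coe_nonneg _)).trans h.add_sum_le_J

theorem DissipatesAlong.sum_le (hB : ∀ z, |lam z| ≤ B) (h : P.DissipatesAlong lam α T z v) :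
    ∑ t ∈ Finset.range T, (α ‖(z t, v t) - (P.zs, P.vs)‖₊ : ℝ) ≤
      P.J T z v - T * P.ℓ (P.zs, P.vs) + 2 * B := by
  linarith [h.add_sum_le_J, abs_le.1 (hB (z 0)), abs_le.1 (hB (z T))]

theorem DissipatesAlong.neg_two_mul_add_le_J (hB : ∀ z, |lam z| ≤ B)
    (h : P.DissipatesAlong lam α T z v) : -(2 * B) + T * P.ℓ (P.zs, P.vs) ≤ P.J T z v := by
  linarith [h.le_J, abs_le.1 (hB (z 0)), abs_le.1 (hB (z T))]

theorem tendsto_zs_of_sum_le (hα : ClassKInf α)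
    (h : ∀ T, ∑ t ∈ Finset.range T, (α ‖(z t, v t) - (P.zs, P.vs)‖₊ : ℝ) ≤ S) :
    Tendsto z atTop (𝓝 P.zs) := by
  have hlim := NNReal.tendsto_coe.2 (hα.tendsto_zero_of_sum_le h)
  exact tendsto_iff_norm_sub_tendsto_zero.2 <| squeeze_zero (fun _ => norm_nonneg _)
    (fun t => norm_fst_le ((z t, v t) - (P.zs, P.vs))) hlim

theorem exists_forall_mem_nhds_zs_of_sum_le (hα : ClassKInf α) {U : Set (EuclideanSpace ℝ (Fin n))}
    (hU : U ∈ 𝓝 P.zs) (S : ℝ) :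
    ∃ K : ℕ, ∀ (z : ℕ → EuclideanSpace ℝ (Fin n)) (v : ℕ → EuclideanSpace ℝ (Fin m)),
      ∑ t ∈ Finset.range K, (α ‖(z t, v t) - (P.zs, P.vs)‖₊ : ℝ) ≤ S → ∃ k < K, z k ∈ U := by
  obtain ⟨d, hd, hdU⟩ := Metric.mem_nhds_iff.1 hU
  lift d to ℝ≥0 using hd.le
  have hαd : 0 < (α d : ℝ) := NNReal.coe_pos.2 (hα.2.2.1 ▸ hα.2.1 (NNReal.coe_pos.1 hd))
  obtain ⟨K, hK⟩ := exists_nat_gt (S / α d)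
  refine ⟨K, fun z v hS => ?_⟩
  have hlt : ∑ t ∈ Finset.range K, (α ‖(z t, v t) - (P.zs, P.vs)‖₊ : ℝ) <
      ∑ _t ∈ Finset.range K, (α d : ℝ) := by
    rw [Finset.sum_const, Finset.card_range, nsmul_eq_mul]
    exact hS.trans_lt ((div_lt_iff₀ hαd).1 hK)
  obtain ⟨k, hk, hαk⟩ := Finset.exists_lt_of_sum_lt hlt
  refine ⟨k, Finset.mem_range.1 hk, hdU (mem_ball_iff_norm.2 ?_)⟩
  exact (norm_fst_le ((z k, v k) - (P.zs, P.vs))).trans_lt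
    (hα.2.1.lt_iff_lt.1 (NNReal.coe_lt_coe.1 hαk))

/-! ### Continuity of the storage function at the steady state -/

theorem exists_storage_sub_le (hℓ : ContinuousAt P.ℓ (P.zs, P.vs))
    (h_int : (P.zs, P.vs) ∈ interior P.Zbar) (h_ctrl : P.LocallyControllable)
    (h : P.StrictlyDissipative lam α) {η : ℝ} (hη : 0 < η) :
    ∃ δ > 0, ∀ y y', ‖y - P.zs‖ ≤ δ → ‖y' - P.zs‖ ≤ δ → lam y' - lam y ≤ η := by
  obtain ⟨M, hM, hctrl⟩ := h_ctrl
  have hM₀ : (0 : ℝ) < M := Nat.cast_pos.2 hM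
  have hnear : ∀ᶠ p in 𝓝 (P.zs, P.vs), p ∈ P.Zbar ∧ P.ℓ p ≤ P.ℓ (P.zs, P.vs) + η / M :=
    Eventually.and (mem_interior_iff_mem_nhds.1 h_int)
      (hℓ.eventually_le_const (lt_add_of_pos_right _ (by positivity)))
  obtain ⟨ε, hε, hball⟩ := Metric.nhds_basis_closedBall.eventually_iff.1 hnear
  obtain ⟨δ, hδ, hjoin⟩ := hctrl ε hε
  refine ⟨δ, hδ, fun y y' hy hy' => ?_⟩
  obtain ⟨z, v, rfl, rfl, hz⟩ := hjoin y y' hy hy'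
  have hp (t : ℕ) (ht : t < M) := hball (mem_closedBall_iff_norm.2 (hz t ht).2)
  have hadm : P.Admissible M (z 0) z v := ⟨rfl, fun t ht => ⟨(hz t ht).1, (hp t ht).1⟩⟩
  have hJ : P.J M z v ≤ M * P.ℓ (P.zs, P.vs) + η := calc
    P.J M z v ≤ ∑ _t ∈ Finset.range M, (P.ℓ (P.zs, P.vs) + η / M) :=
      Finset.sum_le_sum fun t ht => (hp t (Finset.mem_range.1 ht)).2
    _ = M * P.ℓ (P.zs, P.vs) + η := by
      rw [Finset.sum_const, Finset.card_range, nsmul_eq_mul, mul_add, mul_div_cancel₀ η hM₀.ne']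
  linarith [(hadm.dissipatesAlong h).le_J]

theorem continuousAt_storage (hℓ : ContinuousAt P.ℓ (P.zs, P.vs))
    (h_int : (P.zs, P.vs) ∈ interior P.Zbar) (h_ctrl : P.LocallyControllable)
    (h : P.StrictlyDissipative lam α) : ContinuousAt lam P.zs := by
  refine Metric.nhds_basis_ball.tendsto_right_iff.2 fun η hη => ?_
  obtain ⟨δ, hδ, hle⟩ := exists_storage_sub_le hℓ h_int h_ctrl h (half_pos hη)
  filter_upwards [Metric.closedBall_mem_nhds P.zs hδ] with y hy
  have hy' := mem_closedBall_iff_norm.1 hy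
  have hzs : ‖P.zs - P.zs‖ ≤ δ := by simpa using hδ.le
  rw [mem_ball_iff_norm, Real.norm_eq_abs]
  exact (abs_le.2 ⟨by linarith [hle _ _ hy' hzs], hle _ _ hzs hy'⟩).trans_lt (half_lt_self hη)

/-! ### Infinite-horizon costs -/

theorem AdmissibleInf.sum_le (hs : P.ℓ (P.zs, P.vs) = 0) (h : P.StrictlyDissipative lam α)
    (hB : ∀ z, |lam z| ≤ B) (hz : P.AdmissibleInf z₀ z v) (hC : P.Jinf z v < C) (T : ℕ) :
    ∑ t ∈ Finset.range T, (α ‖(z t, v t) - (P.zs, P.vs)‖₊ : ℝ) ≤ C + 2 * B := by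
  obtain ⟨T', hT, hJ⟩ := ((eventually_ge_atTop T).and (eventually_lt_of_limsup_lt hC)).exists
  have hmono := Finset.sum_le_sum_of_subset_of_nonneg (Finset.range_mono hT)
    fun t _ _ => NNReal.coe_nonneg (α ‖(z t, v t) - (P.zs, P.vs)‖₊)
  have hsum := ((hz.take T').dissipatesAlong h).sum_le hB
  rw [hs, mul_zero, sub_zero] at hsum
  linarith [EReal.coe_lt_coe_iff.1 hJ]

theorem AdmissibleInf.J_sub_le_Jinf (hs : P.ℓ (P.zs, P.vs) = 0) (h : P.StrictlyDissipative lam α)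
    (hz : P.AdmissibleInf z₀ z v) {c : ℝ} (hc : ∀ᶠ T in atTop, lam (z k) - lam (z T) ≤ c) :
    ((P.J k z v - c : ℝ) : EReal) ≤ P.Jinf z v := by
  refine le_limsup_of_frequently_le (Eventually.frequently ?_)
  filter_upwards [hc, eventually_ge_atTop k] with T hT hk
  obtain ⟨l, rfl⟩ := Nat.exists_eq_add_of_le hk
  have htail := (((hz.shift k).take l).dissipatesAlong h).le_J
  simp only [hs, mul_zero, add_zero] at htail
  rw [J_add]
  exact EReal.coe_le_coe (by linarith)

theorem neg_two_mul_le_Vinf (hs : P.ℓ (P.zs, P.vs) = 0) (h : P.StrictlyDissipative lam α)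
    (hB : ∀ z, |lam z| ≤ B) (z₀ : EuclideanSpace ℝ (Fin n)) :
    ((-(2 * B) : ℝ) : EReal) ≤ P.Vinf z₀ := by
  refine le_sInf ?_
  rintro _ ⟨z, v, hz, rfl⟩
  have hle := hz.J_sub_le_Jinf (k := 0) hs h (c := 2 * B) (Eventually.of_forall fun T => by
    linarith [abs_le.1 (hB (z 0)), abs_le.1 (hB (z T))])
  simpa [J] using hle

theorem Vinf_ne_bot (hs : P.ℓ (P.zs, P.vs) = 0) (h : P.StrictlyDissipative lam α)
    (z₀ : EuclideanSpace ℝ (Fin n)) : P.Vinf z₀ ≠ ⊥ := by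
  obtain ⟨B, hB⟩ := h.2.1
  exact ((EReal.bot_lt_coe _).trans_le (neg_two_mul_le_Vinf hs h hB z₀)).ne'

theorem Vinf_ne_top {κ : ℝ≥0} (hℓ : LipschitzOnWith κ P.ℓ P.Zbar)
    (hmem : (P.zs, P.vs) ∈ P.Zbar) (h_reach : P.ExponentiallyReachable)
    (hs : P.ℓ (P.zs, P.vs) = 0) (hN : 1 ≤ N) (hz₀ : z₀ ∈ P.XN N) : P.Vinf z₀ ≠ ⊤ := by
  obtain ⟨c, ρ, hc, hρ, hρ1, hreach⟩ := h_reach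
  obtain ⟨z, v, hz, hb⟩ := hreach N hN z₀ hz₀
  have hstage (t : ℕ) : P.ℓ (z t, v t) ≤ κ * (c * ρ ^ t) := calc
    P.ℓ (z t, v t) ≤ dist (P.ℓ (z t, v t)) (P.ℓ (P.zs, P.vs)) := by
      rw [hs, Real.dist_0_eq_abs]
      exact le_abs_self _
    _ ≤ κ * ‖(z t, v t) - (P.zs, P.vs)‖ :=
      (hℓ.dist_le_mul _ (hz.2 t).2 _ hmem).trans_eq (by rw [dist_eq_norm])
    _ ≤ κ * (c * ρ ^ t) := by gcongr; exact hb t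
  have hJ (T : ℕ) : P.J T z v ≤ κ * (c * (1 - ρ)⁻¹) := calc
    P.J T z v ≤ ∑ t ∈ Finset.range T, κ * (c * ρ ^ t) := Finset.sum_le_sum fun t _ => hstage t
    _ = κ * (c * ∑ t ∈ Finset.range T, ρ ^ t) := by simp only [Finset.mul_sum]
    _ ≤ κ * (c * (1 - ρ)⁻¹) := by
      gcongr
      rw [← tsum_geometric_of_lt_one hρ hρ1]
      exact (summable_geometric_of_lt_one hρ hρ1).sum_le_tsum _ fun t _ => pow_nonneg hρ t
  have hJinf : P.Jinf z v ≤ ((κ * (c * (1 - ρ)⁻¹) : ℝ) : EReal) :=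
    limsup_le_of_le (h := Eventually.of_forall fun T => EReal.coe_le_coe (hJ T))
  have hVinf : P.Vinf z₀ ≤ P.Jinf z v := sInf_le ⟨z, v, hz, rfl⟩
  exact ((hVinf.trans hJinf).trans_lt (EReal.coe_lt_top _)).ne

theorem Vinf_eq_top (hs : 0 < P.ℓ (P.zs, P.vs)) (h : P.StrictlyDissipative lam α)
    (z₀ : EuclideanSpace ℝ (Fin n)) : P.Vinf z₀ = ⊤ := by
  obtain ⟨B, hB⟩ := h.2.1
  refine sInf_eq_top.2 ?_
  rintro _ ⟨z, v, hz, rfl⟩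
  have hlim : Tendsto (fun T : ℕ => P.J T z v) atTop atTop :=
    tendsto_atTop_mono (fun T => ((hz.take T).dissipatesAlong h).neg_two_mul_add_le_J hB)
      (tendsto_atTop_add_const_left _ _ (tendsto_natCast_atTop_atTop.atTop_mul_const hs))
  exact (EReal.tendsto_coe_nhds_top_iff.2 hlim).limsup_eq

/-! ### Optimal values near the steady state -/

theorem exists_abs_V_sub_le (h_reach : P.ExponentiallyReachable) (h_cont : P.ValueContinuity) :
    ∃ C : ℝ≥0, ∀ N, 1 ≤ N → ∀ z ∈ P.XN N, |P.V N z - P.V N P.zs| ≤ C := by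
  obtain ⟨c, ρ, hc, -, -, hreach⟩ := h_reach
  obtain ⟨αV, hαV, hV⟩ := h_cont
  lift c to ℝ≥0 using hc
  refine ⟨αV c, fun N hN z₀ hz₀ => (hV N hN z₀ hz₀).trans ?_⟩
  obtain ⟨z, v, ⟨rfl, -⟩, hb⟩ := hreach N hN z₀ hz₀
  have hnorm : ‖z 0 - P.zs‖ ≤ c :=
    (norm_fst_le ((z 0, v 0) - (P.zs, P.vs))).trans (by simpa using hb 0)
  exact NNReal.coe_le_coe.2 (hαV.2.1.monotone hnorm)

theorem ValueContinuity.eventually_abs_V_sub_lt (h_cont : P.ValueContinuity) {η : ℝ}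
    (hη : 0 < η) :
    ∀ᶠ y in 𝓝 P.zs, ∀ N, 1 ≤ N → y ∈ P.XN N → |P.V N y - P.V N P.zs| < η := by
  obtain ⟨αV, ⟨hcont, -, hzero, -⟩, hV⟩ := h_cont
  have hlim : Tendsto (fun y => (αV ‖y - P.zs‖₊ : ℝ)) (𝓝 P.zs) (𝓝 0) := by
    have hc : Continuous fun y => (αV ‖y - P.zs‖₊ : ℝ) := by fun_prop
    simpa [hzero] using hc.tendsto P.zs
  filter_upwards [hlim.eventually_lt_const hη] with y hy N hN hyN
  exact (hV N hN y hyN).trans_lt hy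

theorem ValueContinuity.continuousWithinAt (h_cont : P.ValueContinuity) (hN : 1 ≤ N) :
    ContinuousWithinAt (P.V N) (P.XN N) P.zs := by
  refine Metric.nhds_basis_ball.tendsto_right_iff.2 fun η hη => ?_
  filter_upwards [self_mem_nhdsWithin, (h_cont.eventually_abs_V_sub_lt hη).filter_mono
    nhdsWithin_le_nhds] with y hyN hy
  exact hy N hN hyN

section Performance

variable {zopt : ℕ → EuclideanSpace ℝ (Fin n) → ℕ → EuclideanSpace ℝ (Fin n)}
  {vopt : ℕ → EuclideanSpace ℝ (Fin n) → ℕ → EuclideanSpace ℝ (Fin m)}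
  {ini : ℕ → EuclideanSpace ℝ (Fin n) → EuclideanSpace ℝ (Fin n)}

theorem exists_tendsto_V_zs (h_opt : P.IsOptimalSelection zopt vopt) (h_term : P.TerminalDecrease)
    (hXf : P.zs ∈ P.Xf) (h_reach : P.ExponentiallyReachable) (h : P.StrictlyDissipative lam α)
    (h_cont : P.ValueContinuity) (hs : P.ℓ (P.zs, P.vs) = 0) :
    ∃ V₀, Tendsto (fun N => P.V N P.zs) atTop (𝓝 V₀) := by
  obtain ⟨B, hB⟩ := h.2.1
  obtain ⟨C, hC⟩ := exists_abs_V_sub_le h_reach h_cont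
  have hanti : Antitone fun N => P.V (N + 1) P.zs := antitone_nat_of_succ_le fun N => by
    simpa [hs] using V_succ_le h_opt h_term (Nat.le_add_left 1 N) (Xf_subset_XN h_term _ hXf)
  have hbdd : BddBelow (Set.range fun N => P.V (N + 1) P.zs) := by
    refine ⟨-(2 * B) + (P.V 1 P.zs - C), Set.forall_mem_range.2 fun N => ?_⟩
    have hzs := Xf_subset_XN h_term (N + 1) hXf
    obtain ⟨hadm, hend⟩ := (h_opt _ (Nat.le_add_left 1 N) _ hzs).1
    have hJ := (hadm.dissipatesAlong h).neg_two_mul_add_le_J hB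
    have hVf := V_one_le h_opt h_term hend
    have hV := abs_le.1 (hC 1 le_rfl _ (Xf_subset_XN h_term 1 hend))
    rw [hs] at hJ hVf
    rw [V_eq h_opt (Nat.le_add_left 1 N) hzs]
    linarith
  exact ⟨_, (tendsto_add_atTop_iff_nat 1).1 (tendsto_atTop_ciInf hanti hbdd)⟩

theorem eventually_V_sub_le_Jinf (h_opt : P.IsOptimalSelection zopt vopt)
    (h_term : P.TerminalDecrease) (hXf : P.Xf ∈ 𝓝 P.zs) (h_reach : P.ExponentiallyReachable)
    (h : P.StrictlyDissipative lam α) (hlam : ContinuousAt lam P.zs) (h_cont : P.ValueContinuity)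
    (hs : P.ℓ (P.zs, P.vs) = 0) (C : ℝ) {η : ℝ} (hη : 0 < η) :
    ∀ᶠ N in atTop, ∀ z₀ z v, P.AdmissibleInf z₀ z v → P.Jinf z v < C →
      ((P.V N z₀ - P.V N P.zs - 4 * η : ℝ) : EReal) ≤ P.Jinf z v := by
  obtain ⟨B, hB⟩ := h.2.1
  have hnear : ∀ᶠ y in 𝓝 P.zs, y ∈ P.Xf ∧ lam y ∈ Metric.ball (lam P.zs) η ∧
      ∀ N, 1 ≤ N → y ∈ P.XN N → |P.V N y - P.V N P.zs| < η :=
    Eventually.and hXf ((hlam.eventually_mem (Metric.ball_mem_nhds _ hη)).and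
      (h_cont.eventually_abs_V_sub_lt hη))
  obtain ⟨K, hK⟩ := exists_forall_mem_nhds_zs_of_sum_le h.1 hnear (C + 2 * B)
  obtain ⟨V₀, hV₀⟩ := exists_tendsto_V_zs h_opt h_term (mem_of_mem_nhds hXf) h_reach h h_cont hs
  obtain ⟨N₁, hN₁⟩ := Metric.cauchySeq_iff.1 hV₀.cauchySeq η hη
  filter_upwards [eventually_ge_atTop (N₁ + K)] with N hN z₀ z v hz hC
  have hsum := hz.sum_le hs h hB hC
  obtain ⟨k, hk, hzXf, hzlam, hzV⟩ := hK z v (hsum K)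
  obtain ⟨l, rfl⟩ := Nat.exists_eq_add_of_le (show k ≤ N by omega)
  have hl : 1 ≤ l := by omega
  have hzN := Xf_subset_XN h_term l hzXf
  have hswitch : P.V (k + l) z₀ ≤ P.J k z v + P.V l (z k) := (hz.take k).V_add_le h_opt hl hzN
  have hzs : P.V l (z k) < P.V l P.zs + η := by linarith [abs_lt.1 (hzV l hl hzN)]
  have hcauchy : P.V l P.zs < P.V (k + l) P.zs + η := by
    have := hN₁ l (by omega) (k + l) (by omega)
    rw [Real.dist_eq] at this
    linarith [abs_lt.1 this]
  have htail : ((P.J k z v - 2 * η : ℝ) : EReal) ≤ P.Jinf z v := by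
    refine hz.J_sub_le_Jinf hs h ?_
    filter_upwards [(tendsto_zs_of_sum_le h.1 hsum).eventually hnear] with T hT
    have hk' := abs_lt.1 (mem_ball_iff_norm.1 hzlam)
    have hT' := abs_lt.1 (mem_ball_iff_norm.1 hT.2.1)
    linarith
  exact (EReal.coe_le_coe (by linarith)).trans htail

theorem exists_classL_V_sub_le_Vinf (h_opt : P.IsOptimalSelection zopt vopt)
    (h_term : P.TerminalDecrease) (hXf : P.Xf ∈ 𝓝 P.zs) (h_reach : P.ExponentiallyReachable)
    (h : P.StrictlyDissipative lam α) (hlam : ContinuousAt lam P.zs) (h_cont : P.ValueContinuity)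
    (hs : P.ℓ (P.zs, P.vs) = 0) :
    ∃ δ : ℝ≥0 → ℝ≥0, ClassL δ ∧ ∀ N : ℕ, 1 ≤ N → ∀ z₀ ∈ P.XN N,
      ((P.V N z₀ - P.V N P.zs : ℝ) : EReal) ≤ P.Vinf z₀ + ((δ N : ℝ) : EReal) := by
  obtain ⟨B, hB⟩ := h.2.1
  lift B to ℝ≥0 using (abs_nonneg _).trans (hB 0)
  obtain ⟨C, hC⟩ := exists_abs_V_sub_le h_reach h_cont
  refine exists_classL_of_eventually (Q := fun N a => 1 ≤ N → ∀ z₀ ∈ P.XN N,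
    ((P.V N z₀ - P.V N P.zs : ℝ) : EReal) ≤ P.Vinf z₀ + ((a : ℝ) : EReal)) ?_ ?_ ?_
  · intro N a b hab hQ hN z₀ hz₀
    refine (hQ hN z₀ hz₀).trans ?_
    gcongr
  · refine fun N => ⟨C + 2 * B, fun hN z₀ hz₀ => ?_⟩
    refine le_trans ?_ (add_le_add_left (neg_two_mul_le_Vinf hs h hB z₀) _)
    rw [← EReal.coe_add]
    refine EReal.coe_le_coe ((le_abs_self _).trans ((hC N hN z₀ hz₀).trans_eq ?_))
    push_cast
    ring
  · intro η hη
    filter_upwards [eventually_V_sub_le_Jinf h_opt h_term hXf h_reach h hlam h_cont hs C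
      (η := η / 4) (by positivity)] with N hev hN z₀ hz₀
    rw [← EReal.sub_le_iff_le_add (.inl (EReal.coe_ne_bot _)) (.inl (EReal.coe_ne_top _)),
      ← EReal.coe_sub]
    refine le_sInf ?_
    rintro _ ⟨z, v, hz, rfl⟩
    rcases lt_or_ge (P.Jinf z v) (C : ℝ) with hlt | hge
    · simpa [mul_div_cancel₀] using hev z₀ z v hz hlt
    · refine (EReal.coe_le_coe ?_).trans hge
      linarith [abs_le.1 (hC N hN z₀ hz₀), η.coe_nonneg]

/-! ### Closed-loop performance -/

theorem IsClosedLoop.tendsto_zs (h_opt : P.IsOptimalSelection zopt vopt)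
    (h_ini : P.IsOptimalInitial ini) (h_term : P.TerminalDecrease) (hα : ClassKInf α)
    (hB : ∀ z, |lam z| ≤ B) (h' : P.StronglyDissipative vopt ini lam α) (hN : 1 ≤ N)
    (hC : ∀ y ∈ P.XN N, C ≤ P.V N y) (hz : P.IsClosedLoop vopt ini N z) :
    Tendsto z atTop (𝓝 P.zs) := by
  refine tendsto_zs_of_sum_le hα (v := fun t => vopt N (z t) 0)
    (S := P.V N (z 0) - C + 2 * B) fun T => ?_
  have hX := hz.mem_XN h_opt h_ini h_term hN
  have hdiss : P.DissipatesAlong lam α T z (fun t => vopt N (z t) 0) :=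
    fun t _ => h' N hN (z t) (hX t) _ (hz.2 t)
  linarith [hdiss.sum_le hB, hz.J_le h_opt h_ini h_term hN T, hC _ (hX T)]

theorem IsClosedLoop.JclInf_le (h_opt : P.IsOptimalSelection zopt vopt)
    (h_ini : P.IsOptimalInitial ini) (h_term : P.TerminalDecrease) (hN : 1 ≤ N)
    (hV : ContinuousWithinAt (P.V N) (P.XN N) P.zs) (hs : P.ℓ (P.zs, P.vs) = 0)
    (hz : P.IsClosedLoop vopt ini N z) (hlim : Tendsto z atTop (𝓝 P.zs)) :
    P.JclInf vopt N z ≤ ((P.V N (z 0) - P.V N P.zs : ℝ) : EReal) := by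
  have hX := hz.mem_XN h_opt h_ini h_term hN
  have hVlim : Tendsto (fun T => P.V N (z T)) atTop (𝓝 (P.V N P.zs)) :=
    hV.tendsto.comp (tendsto_nhdsWithin_iff.2 ⟨hlim, Eventually.of_forall hX⟩)
  rw [← (EReal.tendsto_coe.2 (hVlim.const_sub (P.V N (z 0)))).limsup_eq]
  refine limsup_le_limsup (Eventually.of_forall fun T => EReal.coe_le_coe ?_)
  simpa [hs] using hz.J_le h_opt h_ini h_term hN T

theorem IsClosedLoop.JclInf_eq_bot (h_opt : P.IsOptimalSelection zopt vopt)
    (h_ini : P.IsOptimalInitial ini) (h_term : P.TerminalDecrease) (hN : 1 ≤ N)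
    (hC : ∀ y ∈ P.XN N, C ≤ P.V N y) (hs : P.ℓ (P.zs, P.vs) < 0)
    (hz : P.IsClosedLoop vopt ini N z) : P.JclInf vopt N z = ⊥ := by
  have hlim : Tendsto (fun T : ℕ => P.J T z (fun t => vopt N (z t) 0)) atTop atBot := by
    refine tendsto_atBot_mono (fun T => ?_)
      (tendsto_atBot_add_const_left _ (P.V N (z 0) - C)
        (tendsto_natCast_atTop_atTop.atTop_mul_const_of_neg hs))
    linarith [hz.J_le h_opt h_ini h_term hN T, hC _ (hz.mem_XN h_opt h_ini h_term hN T)]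
  exact (EReal.tendsto_coe_nhds_bot_iff.2 hlim).limsup_eq

theorem IsClosedLoop.JclInf_le_Vinf_of_ne (h_opt : P.IsOptimalSelection zopt vopt)
    (h_ini : P.IsOptimalInitial ini) (h_term : P.TerminalDecrease)
    (h : P.StrictlyDissipative lam α) (hN : 1 ≤ N) (hC : ∀ y ∈ P.XN N, C ≤ P.V N y)
    (hs : P.ℓ (P.zs, P.vs) ≠ 0) (hz : P.IsClosedLoop vopt ini N z) :
    P.JclInf vopt N z ≤ P.Vinf (z 0) := by
  rcases hs.lt_or_gt with hneg | hpos
  · exact (hz.JclInf_eq_bot h_opt h_ini h_term hN hC hneg).trans_le bot_le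
  · exact le_top.trans_eq (Vinf_eq_top hpos h (z 0)).symm

end Performance

end Problem

end TubeEMPC

open TubeEMPC.Problem in
theorem mainTheorem1_general {n m q : ℕ} (P : TubeEMPC.Problem n m q)
    (zopt : ℕ → EuclideanSpace ℝ (Fin n) → ℕ → EuclideanSpace ℝ (Fin n))
    (vopt : ℕ → EuclideanSpace ℝ (Fin n) → ℕ → EuclideanSpace ℝ (Fin m))
    (ini : ℕ → EuclideanSpace ℝ (Fin n) → EuclideanSpace ℝ (Fin n))
    (h_opt : P.IsOptimalSelection zopt vopt)
    (h_ini : P.IsOptimalInitial ini)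
    {κ : ℝ≥0} (hℓ : LipschitzOnWith κ P.ℓ P.Zbar)
    (hXf : P.Xf ∈ 𝓝 P.zs)
    (h_term : P.TerminalDecrease)
    (h_int : (P.zs, P.vs) ∈ interior P.Zbar)
    (h_reach : P.ExponentiallyReachable)
    (h_ctrl : P.LocallyControllable)
    (h_diss : P.DissipativityAssumption vopt ini)
    (h_cont : P.ValueContinuity) :
    (∃ δ₁ : ℝ≥0 → ℝ≥0, TubeEMPC.ClassL δ₁ ∧
      ∀ N : ℕ, 1 ≤ N → ∀ z : ℕ → EuclideanSpace ℝ (Fin n),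
        P.IsClosedLoop vopt ini N z →
          P.JclInf vopt N z ≤ P.Vinf (z 0) + (((δ₁ N : ℝ≥0) : ℝ) : EReal)) ∧
    (P.ℓ (P.zs, P.vs) = 0 →
      ∀ N : ℕ, 1 ≤ N → ∀ z₀ ∈ P.XN N, P.Vinf z₀ ≠ ⊤ ∧ P.Vinf z₀ ≠ ⊥) := by
  obtain ⟨lam, α, h, h'⟩ := h_diss
  refine ⟨?_, fun hs N hN z₀ hz₀ =>
    ⟨Vinf_ne_top hℓ (interior_subset h_int) h_reach hs hN hz₀, Vinf_ne_bot hs h z₀⟩⟩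
  obtain ⟨B, hB⟩ := h.2.1
  obtain ⟨C, hC⟩ := exists_abs_V_sub_le h_reach h_cont
  have hV (N : ℕ) (hN : 1 ≤ N) : ∀ y ∈ P.XN N, P.V N P.zs - C ≤ P.V N y := fun y hy => by
    linarith [abs_le.1 (hC N hN y hy)]
  by_cases hs : P.ℓ (P.zs, P.vs) = 0
  · have hlam : ContinuousAt lam P.zs := continuousAt_storage
      (hℓ.continuousOn.continuousAt (mem_interior_iff_mem_nhds.1 h_int)) h_int h_ctrl h
    obtain ⟨δ, hδ, hδV⟩ :=
      exists_classL_V_sub_le_Vinf h_opt h_term hXf h_reach h hlam h_cont hs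
    refine ⟨δ, hδ, fun N hN z hz => le_trans ?_ (hδV N hN _ hz.1)⟩
    exact hz.JclInf_le h_opt h_ini h_term hN (h_cont.continuousWithinAt hN) hs
      (hz.tendsto_zs h_opt h_ini h_term h.1 hB h' hN (hV N hN))
  · refine ⟨_, TubeEMPC.classL_one_add_inv, fun N hN z hz => ?_⟩
    exact (hz.JclInf_le_Vinf_of_ne h_opt h_ini h_term h hN (hV N hN) hs).trans
      (le_add_of_nonneg_right (EReal.coe_nonneg.2 (NNReal.coe_nonneg _)))

theorem mainTheorem1 {n m q : ℕ} (P : TubeEMPC.Problem n m q)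
    (zopt : ℕ → EuclideanSpace ℝ (Fin n) → ℕ → EuclideanSpace ℝ (Fin n))
    (vopt : ℕ → EuclideanSpace ℝ (Fin n) → ℕ → EuclideanSpace ℝ (Fin m))
    (ini : ℕ → EuclideanSpace ℝ (Fin n) → EuclideanSpace ℝ (Fin n))
    (h_opt : P.IsOptimalSelection zopt vopt)
    (h_ini : P.IsOptimalInitial ini)
    (h_sets : P.ConstraintSets)
    (h_rci : P.RCIAssumption)
    (h_cost : P.StageCostAssumption)
    (h_term : P.TerminalAssumption)
    (h_ross : P.ROSSAssumption)
    (h_reach : P.ExponentiallyReachable)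
    (h_ctrl : P.LocallyControllable)
    (h_diss : P.DissipativityAssumption vopt ini)
    (h_cont : P.ValueContinuity) :
    (∃ δ₁ : ℝ≥0 → ℝ≥0, TubeEMPC.ClassL δ₁ ∧
      ∀ N : ℕ, 1 ≤ N → ∀ z : ℕ → EuclideanSpace ℝ (Fin n),
        P.IsClosedLoop vopt ini N z →
          P.JclInf vopt N z ≤ P.Vinf (z 0) + (((δ₁ N : ℝ≥0) : ℝ) : EReal)) ∧
    (P.ℓ (P.zs, P.vs) = 0 →
      ∀ N : ℕ, 1 ≤ N → ∀ z₀ ∈ P.XN N, P.Vinf z₀ ≠ ⊤ ∧ P.Vinf z₀ ≠ ⊥) := by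
  obtain ⟨-, -, κ, -, hℓ⟩ := h_cost
  exact mainTheorem1_general P zopt vopt ini h_opt h_ini (hℓ.mono h_rci.2.2.2)
    (mem_interior_iff_mem_nhds.1 h_term.2.1) h_term.2.2.2 h_ross.2.2 h_reach h_ctrl h_diss h_cont
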